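/- Let $K$ be a field and let $\Sigma$ be a finite alphabet. For an associative unital $K$-algebra $A$, a right $A$-module $M$ is called exhaustively amenable if for every finite-dimensional subspace $V\le A$, every $\varepsilon>0$ and every finite-dimensional subspace $W\le M$ there is a finite-dimensional subspace $L\le M$ containing $W$ with $\dim_K LV<(1+\varepsilon)\dim_K L$, where $LV$ is the span of the products $lv$ with $l\in L$, $v\in V$; left modules are treated analogously, with $VL$ in place of $LV$. A monomial algebra over $\Sigma$ is a quotient $K\langle\Sigma\rangle/I$ of the free algebra by a two-sided ideal $I$ generated by words (monomials); it is graded by word length. It is projectively simple if it is infinite-dimensional and each of its non-zero homogeneous two-sided ideals has finite codimension. A subshift $X\subseteq\Sigma^{\mathbb Z}$ is a non-empty closed shift-invariant subset; it is minimal if it contains no non-empty proper subshift. The algebra $A_X$ of a subshift $X$ is the monomial algebra $K\langle\Sigma\rangle/I_X$, where $I_X$ is generated by the words that are not finite factors of elements of $X$; thus it is spanned by the finite factors of $X$, with concatenation as product, where a product that is not a factor of $X$ is $0$. **Theorem.** If $X$ is a minimal subshift, then every non-zero left or right $A_X$-module is exhaustively amenable. Equivalently, every non-zero left or right module over a projectively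 simple monomial algebra is exhaustively amenable. -/

import Mathlib

open SymbolicDynamics.FullShift MulOpposite

/-! ### Amenability of modules -/

section Amenability

/-- The subspace `V L` of a left module `M`, spanned by the products `v • l`. -/
def leftProd (K : Type*) {A M : Type*} [Field K] [Ring A] [Algebra K A]
    [AddCommGroup M] [Module K M] [Module A M]
    (V : Submodule K A) (L : Submodule K M) : Submodule K M :=
  Submodule.span K {m | ∃ v ∈ V, ∃ l ∈ L, m = v • l}

/-- The subspace `L V` of a right module `M`, spanned by the products `l v`.
A right module is a module over the opposite ring, so that `l v` is `op v • l`. -/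
def rightProd (K : Type*) {A M : Type*} [Field K] [Ring A] [Algebra K A]
    [AddCommGroup M] [Module K M] [Module Aᵐᵒᵖ M]
    (L : Submodule K M) (V : Submodule K A) : Submodule K M :=
  Submodule.span K {m | ∃ v ∈ V, ∃ l ∈ L, m = op v • l}

/-- A left `A`-module `M` is exhaustively amenable: for all finite-dimensional `V ≤ A` and
`W ≤ M` and all `ε > 0` there is a finite-dimensional `L ≤ M` containing `W` such that
`dim (V L) < (1 + ε) dim L`. -/
def LeftExhaustivelyAmenable (K A M : Type*) [Field K] [Ring A] [Algebra K A]
    [AddCommGroup M] [Module K M] [Module A M] : Prop :=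
  ∀ V : Submodule K A, FiniteDimensional K V → ∀ ε : ℝ, 0 < ε →
    ∀ W : Submodule K M, FiniteDimensional K W →
      ∃ L : Submodule K M, FiniteDimensional K L ∧ W ≤ L ∧
        (Module.finrank K (leftProd K V L) : ℝ) < (1 + ε) * (Module.finrank K L : ℝ)

/-- A right `A`-module `M` is exhaustively amenable: for all finite-dimensional `V ≤ A` and
`W ≤ M` and all `ε > 0` there is a finite-dimensional `L ≤ M` containing `W` such that
`dim (L V) < (1 + ε) dim L`. -/
def RightExhaustivelyAmenable (K A M : Type*) [Field K] [Ring A] [Algebra K A]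
    [AddCommGroup M] [Module K M] [Module Aᵐᵒᵖ M] : Prop :=
  ∀ V : Submodule K A, FiniteDimensional K V → ∀ ε : ℝ, 0 < ε →
    ∀ W : Submodule K M, FiniteDimensional K W →
      ∃ L : Submodule K M, FiniteDimensional K L ∧ W ≤ L ∧
        (Module.finrank K (rightProd K L V) : ℝ) < (1 + ε) * (Module.finrank K L : ℝ)

end Amenability

/-! ### Monomial algebras -/

section Monomial

/-- The monomial `x_{i_1} ⋯ x_{i_r}` of the free algebra that is given by a finite word. -/
noncomputable def freeMonomial (K : Type*) {α : Type*} [Field K] (w : List α) :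
    FreeAlgebra K α :=
  (w.map (FreeAlgebra.ι K)).prod

/-- The monomial relations `w = 0`, for the words `w` of a set `R`. -/
inductive MonomialRel (K : Type*) {α : Type*} [Field K] (R : Set (List α)) :
    FreeAlgebra K α → FreeAlgebra K α → Prop
  | of (w : List α) (hw : w ∈ R) : MonomialRel K R (freeMonomial K w) 0

/-- The monomial algebra `K⟨α⟩ / I`, where `I` is the two-sided ideal generated by the monomials
in `R`. -/
abbrev MonomialAlgebra (K : Type*) {α : Type*} [Field K] (R : Set (List α)) :=
  RingQuot (MonomialRel K R)

/-- The image of a word in the monomial algebra. -/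
noncomputable def monomialOf (K : Type*) {α : Type*} [Field K] (R : Set (List α))
    (w : List α) : MonomialAlgebra K R :=
  RingQuot.mkAlgHom K (MonomialRel K R) (freeMonomial K w)

/-- The homogeneous component of degree `n`: the span of the monomials of length `n`. -/
noncomputable def monomialDegree (K : Type*) {α : Type*} [Field K] (R : Set (List α)) (n : ℕ) :
    Submodule K (MonomialAlgebra K R) :=
  Submodule.span K {a | ∃ w : List α, w.length = n ∧ a = monomialOf K R w}

end Monomial

section ProjectivelySimple

/-- A two-sided ideal, viewed as a subspace. -/
def idealSubspace (K : Type*) {A : Type*} [Field K] [Ring A] [Algebra K A]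
    (J : TwoSidedIdeal A) : Submodule K A :=
  (TwoSidedIdeal.asIdeal J).restrictScalars K

/-- `J` is homogeneous with respect to the components `𝒜 n`: each of its elements is a sum of
homogeneous elements of `J`. -/
def IsHomogeneousIdeal (K : Type*) {A : Type*} [Field K] [Ring A] [Algebra K A]
    (𝒜 : ℕ → Submodule K A) (J : TwoSidedIdeal A) : Prop :=
  idealSubspace K J ≤ ⨆ n, idealSubspace K J ⊓ 𝒜 n

/-- A graded algebra with components `𝒜 n` is projectively simple if it is infinite-dimensional
and all its non-zero homogeneous two-sided ideals have finite codimension. -/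
def IsProjectivelySimple (K : Type*) {A : Type*} [Field K] [Ring A] [Algebra K A]
    (𝒜 : ℕ → Submodule K A) : Prop :=
  ¬ FiniteDimensional K A ∧
    ∀ J : TwoSidedIdeal A, J ≠ ⊥ → IsHomogeneousIdeal K 𝒜 J →
      FiniteDimensional K (A ⧸ idealSubspace K J)

end ProjectivelySimple

/-! ### Subshifts and their algebras -/

section Subshifts

/-- A subshift of `α^ℤ` is minimal if it is non-empty and contains no non-empty subshift other
than itself. -/
def IsMinimalSubshift {α : Type*} [TopologicalSpace α] (X : Subshift α ℤ) : Prop :=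
  X.carrier.Nonempty ∧
    ∀ Y : Subshift α ℤ, Y.carrier.Nonempty → Y.carrier ⊆ X.carrier → Y.carrier = X.carrier

/-- The finite words that occur as factors of elements of `X`. -/
def factors {α : Type*} [TopologicalSpace α] (X : Subshift α ℤ) : Set (List α) :=
  {w | ∃ x ∈ X.carrier, ∃ i : ℤ, ∀ (j : ℕ) (hj : j < w.length), x (i + j) = w[j]}

/-- The monomial algebra `A_X`: words multiply by concatenation, and a word is set to be zero
if it is not a factor of `X`. -/
abbrev SubshiftAlgebra (K : Type*) {α : Type*} [Field K] [TopologicalSpace α]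
    (X : Subshift α ℤ) :=
  MonomialAlgebra K (factors X)ᶜ

end Subshifts

/-!
The theorem follows from three facts about words, operators, and monomial algebras.

*Words.* Call a language uniformly recurrent if it is closed under factors, contains arbitrarily
long words, and each of its words `u` is a factor of all its sufficiently long words. Then for
every `n` it contains a word `w` whose extension by `n` letters is unique
(`IsUniformlyRecurrent.exists_unique_extension`). Otherwise one could branch in two ways within
every `n` letters, and a potential argument (`exists_long_not_infix`) shows that a suitable choice
at each branching avoids a given word `u` forever, if `u` is long in terms of `n`: weigh an
occurrence of `u` that is under way by `lam ^ j`, where `j` letters of it have been read and `1 <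
lam`, `lam ^ n ≤ 3 / 2`. At each branching it survives for at most one of the two choices, so that
the better choice halves the total weight, and the weight stays below the value `lam ^ |u|` of a
completed occurrence.

*Operators.* Let the letters act on an infinite-dimensional space `M` so that the words outside
the language act as `0`. If the finite-dimensional invariant subspaces have unbounded dimension,
they are Følner subspaces. Otherwise there is a largest one, `F`. Let `v` be the unique extension
of length `n` of `w`, as above. Some `m` is not sent into `F` by `w v`, for otherwise all long words,
as they contain `w v`, would send `M` into `F`, and every vector would lie in a finite-dimensional
invariant subspace. The spaces spanned by `F` and the images of `m` under the words `w v₁ ⋯ vᵢ`,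
`i ≤ k`, grow by exactly one dimension with each `k ≤ n`, as a stationary value would be an
invariant subspace beyond `F`; and a letter maps each of them into the next, as it acts as `0` if
it does not continue `v`. Thus words of length at most `r` increase the dimension by at most `r`
(`exists_finrank_letterHull_iterate_le`). Since the dimension can be as large as desired, the sum
with any given finite-dimensional `W` is still a Følner subspace.

*Monomial algebras.* The words that are non-zero in a monomial algebra form a basis of it
(`monomialBasis`). They form a uniformly recurrent language if the algebra is projectively simple,
since the ideal generated by a word `u` has finite codimension
(`IsProjectivelySimple.isUniformlyRecurrent`), and if it is the algebra of a minimal subshift, by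
compactness (`isUniformlyRecurrent_factors`). Left modules are covered by reversing the words.
-/

/-! ### Uniformly recurrent languages -/

/-- A language is uniformly recurrent if it is closed under passing to factors, contains
arbitrarily long words, and each of its words is a factor of all its sufficiently long words. -/
structure IsUniformlyRecurrent {α : Type*} (L : Set (List α)) : Prop where
  mem_of_infix : ∀ ⦃s t : List α⦄, s <:+: t → t ∈ L → s ∈ L
  exists_le_length : ∀ n : ℕ, ∃ w ∈ L, n ≤ w.length
  exists_infix : ∀ u ∈ L, ∃ N : ℕ, ∀ w ∈ L, N ≤ w.length → u <:+: w

namespace IsUniformlyRecurrent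

variable {α : Type*} {L : Set (List α)}

theorem exists_length_eq (hL : IsUniformlyRecurrent L) (n : ℕ) : ∃ w ∈ L, w.length = n := by
  obtain ⟨w, hw, hn⟩ := hL.exists_le_length n
  exact ⟨w.take n, hL.mem_of_infix (List.take_prefix n w).isInfix hw, by simp [hn]⟩

theorem nil_mem (hL : IsUniformlyRecurrent L) : [] ∈ L := by
  obtain ⟨w, hw, -⟩ := hL.exists_le_length 0
  exact hL.mem_of_infix (List.nil_infix) hw

theorem exists_concat_mem (hL : IsUniformlyRecurrent L) {w : List α} (hw : w ∈ L) :
    ∃ a, w ++ [a] ∈ L := by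
  obtain ⟨N, hN⟩ := hL.exists_infix w hw
  obtain ⟨z, hz, hzl⟩ := hL.exists_length_eq (N + 1)
  obtain ⟨z', b, rfl⟩ : ∃ z' b, z = z' ++ [b] := by
    rcases List.eq_nil_or_concat z with rfl | ⟨z', b, h⟩
    · simp at hzl
    · exact ⟨z', b, by simpa using h⟩
  have hz' : z' ∈ L := hL.mem_of_infix (List.prefix_append _ _).isInfix hz
  obtain ⟨p, q, rfl⟩ := hN z' hz' (by simp at hzl; omega)
  -- the letter that follows this occurrence of `w` is the first one of `q ++ [b]`
  obtain ⟨a, q', hq⟩ : ∃ a q', q ++ [b] = a :: q' := by cases q <;> simp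
  refine ⟨a, hL.mem_of_infix ⟨p, q', ?_⟩ hz⟩
  rw [List.append_assoc (p ++ w), hq]
  simp

theorem reverse (hL : IsUniformlyRecurrent L) :
    IsUniformlyRecurrent {w : List α | w.reverse ∈ L} where
  mem_of_infix s t hst ht := hL.mem_of_infix (List.reverse_infix.2 hst) ht
  exists_le_length n := by
    obtain ⟨w, hw, hn⟩ := hL.exists_le_length n
    exact ⟨w.reverse, by simpa using hw, by simpa using hn⟩
  exists_infix u hu := by
    obtain ⟨N, hN⟩ := hL.exists_infix _ hu
    exact ⟨N, fun w hw h => List.reverse_infix.1 (hN _ hw (by simpa using h))⟩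

end IsUniformlyRecurrent

/-! ### Words with a unique extension -/

section Avoidance

variable {α : Type*}

open Classical in
/-- The potential of a word `s` relative to a word `u`: each prefix of `u` that is a suffix of `s`,
i.e. each occurrence of `u` that may be under way at the end of `s`, contributes `lam ^ j`, where
`j` is its length. -/
noncomputable def overlapWeight (lam : ℝ) (u s : List α) : ℝ :=
  ∑ j ∈ Finset.range (u.length + 1), if u.take j <:+ s then lam ^ j else 0

theorem pow_length_le_overlapWeight {lam : ℝ} (hlam : 0 ≤ lam) {u s : List α} (h : u <:+ s) :
    lam ^ u.length ≤ overlapWeight lam u s := by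
  classical
  unfold overlapWeight
  refine le_trans ?_ (Finset.single_le_sum (f := fun j => if u.take j <:+ s then lam ^ j else 0)
    (fun j _ => by positivity) (Finset.mem_range.2 (Nat.lt_succ_self u.length)))
  simp [h]

theorem overlapWeight_nil_le (lam : ℝ) (u : List α) : overlapWeight lam u [] ≤ 1 := by
  classical
  unfold overlapWeight
  rw [Finset.sum_range_succ', Finset.sum_eq_zero]
  · simp
  · intro j hj
    have : u ≠ [] := by rintro rfl; simp at hj
    simp [this]

theorem take_succ_suffix_concat {u s : List α} {a : α} {j : ℕ} (hj : j < u.length) :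
    u.take (j + 1) <:+ s ++ [a] ↔ u.take j <:+ s ∧ u[j] = a := by
  rw [List.take_succ_eq_append_getElem hj]
  constructor
  · rintro ⟨t, ht⟩
    rw [← List.append_assoc] at ht
    obtain ⟨h1, h2⟩ := List.append_inj' ht rfl
    exact ⟨⟨t, h1⟩, by simpa using h2⟩
  · rintro ⟨⟨t, rfl⟩, rfl⟩
    exact ⟨t, by simp⟩

open Classical in
theorem overlapWeight_concat (lam : ℝ) (u s : List α) (a : α) :
    overlapWeight lam u (s ++ [a]) = 1 + lam * ∑ j ∈ Finset.range u.length,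
      if u.take j <:+ s ∧ u[j]? = some a then lam ^ j else 0 := by
  unfold overlapWeight
  rw [Finset.sum_range_succ', Finset.mul_sum, add_comm]
  refine congrArg₂ _ (by simp) (Finset.sum_congr rfl fun j hj => ?_)
  have hj' : j < u.length := Finset.mem_range.1 hj
  simp only [take_succ_suffix_concat hj', List.getElem?_eq_getElem hj', Option.some.injEq]
  split_ifs <;> ring

theorem overlapWeight_concat_le {lam : ℝ} (hlam : 0 ≤ lam) (u s : List α) (a : α) :
    overlapWeight lam u (s ++ [a]) ≤ 1 + lam * overlapWeight lam u s := by
  classical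
  rw [overlapWeight_concat]
  gcongr
  unfold overlapWeight
  rw [Finset.sum_range_succ]
  refine le_add_of_le_of_nonneg (Finset.sum_le_sum fun j _ => ?_) (by positivity)
  by_cases h : u.take j <:+ s
  · simp only [h, true_and, if_true]
    split_ifs <;> simp [pow_nonneg hlam]
  · simp [h]

/-- An occurrence of `u` that is under way can be continued by at most one of two letters. -/
theorem overlapWeight_concat_add_le {lam : ℝ} (hlam : 0 ≤ lam) (u s : List α) {a b : α}
    (hab : a ≠ b) :
    overlapWeight lam u (s ++ [a]) + overlapWeight lam u (s ++ [b]) ≤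
      2 + lam * overlapWeight lam u s := by
  classical
  rw [overlapWeight_concat, overlapWeight_concat]
  have : (∑ j ∈ Finset.range u.length,
      if u.take j <:+ s ∧ u[j]? = some a then lam ^ j else 0) +
      (∑ j ∈ Finset.range u.length,
      if u.take j <:+ s ∧ u[j]? = some b then lam ^ j else 0) ≤ overlapWeight lam u s := by
    unfold overlapWeight
    rw [Finset.sum_range_succ, ← Finset.sum_add_distrib]
    refine le_add_of_le_of_nonneg (Finset.sum_le_sum fun j _ => ?_) (by positivity)
    by_cases h : u.take j <:+ s
    · by_cases ha : u[j]? = some a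
      · simp [h, ha, hab]
      · simp only [h, ha, true_and, if_true, if_false, zero_add]
        split_ifs <;> simp [pow_nonneg hlam]
    · simp [h]
  nlinarith

theorem overlapWeight_append_le {lam : ℝ} (hlam : 1 ≤ lam) (u s y : List α) :
    overlapWeight lam u (s ++ y) ≤ lam ^ y.length * (overlapWeight lam u s + y.length) := by
  induction y using List.reverseRecOn with
  | nil => simp
  | append_singleton y a ih =>
    rw [← List.append_assoc]
    refine (overlapWeight_concat_le (by linarith) u _ a).trans ?_
    have h1 : (1 : ℝ) ≤ lam ^ (y.length + 1) := one_le_pow₀ hlam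
    have h2 := mul_le_mul_of_nonneg_left ih (by linarith : (0 : ℝ) ≤ lam)
    simp only [List.length_append, List.length_singleton, Nat.cast_add, Nat.cast_one]
    calc 1 + lam * overlapWeight lam u (s ++ y)
        ≤ lam ^ (y.length + 1) + lam * (lam ^ y.length * (overlapWeight lam u s + y.length)) := by
          linarith
      _ = _ := by ring

/-- If no prefix of `y` drives the potential up to `lam ^ |u|`, then appending `y` does not create
an occurrence of `u`. -/
theorem not_infix_append {lam : ℝ} (hlam : 0 ≤ lam) {u s y : List α} (hs : ¬ u <:+: s)
    (h : ∀ y', y' <+: y → overlapWeight lam u (s ++ y') < lam ^ u.length) :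
    ¬ u <:+: s ++ y := by
  induction y using List.reverseRecOn with
  | nil => simpa using hs
  | append_singleton y a ih =>
    rw [← List.append_assoc, List.infix_concat_iff]
    rintro (h' | h')
    · have := h _ List.prefix_rfl
      rw [← List.append_assoc] at this
      exact absurd (pow_length_le_overlapWeight hlam h') (not_le.2 this)
    · exact ih (fun y' hy' => h y' (hy'.trans (List.prefix_append _ _))) h'

/-- If from each word of `L` one can branch in two ways within `n` letters, then a word `u` that
is long in terms of `n` can be avoided: at each branching, take the letter that leads to the
smaller potential. -/
theorem exists_long_not_infix {L : Set (List α)} {n : ℕ} {lam : ℝ} (hlam : 1 ≤ lam)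
    (hn : lam ^ n ≤ 3 / 2) (hnil : [] ∈ L)
    (hbranch : ∀ w ∈ L, ∃ (y : List α) (a b : α), y.length < n ∧ a ≠ b ∧
      w ++ y ++ [a] ∈ L ∧ w ++ y ++ [b] ∈ L)
    {u : List α} (hu : 6 * (n : ℝ) + 6 < lam ^ u.length) (k : ℕ) :
    ∃ s ∈ L, k ≤ s.length ∧ ¬ u <:+: s := by
  have hlam0 : 0 ≤ lam := by linarith
  -- `3 * n + 4` is the bound that one round of at most `n` letters, with a halving, preserves
  suffices H : ∃ s ∈ L, k ≤ s.length ∧ ¬ u <:+: s ∧ overlapWeight lam u s ≤ 3 * n + 4 by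
    obtain ⟨s, h1, h2, h3, -⟩ := H
    exact ⟨s, h1, h2, h3⟩
  have hn0 : (0 : ℝ) ≤ n := n.cast_nonneg
  induction k with
  | zero =>
    refine ⟨[], hnil, le_rfl, fun h => ?_, (overlapWeight_nil_le lam u).trans (by linarith)⟩
    rw [List.infix_nil] at h
    subst h
    simp at hu
    linarith
  | succ k ih =>
    obtain ⟨s, hs, hk, hus, hw⟩ := ih
    obtain ⟨y, a, b, hy, hab, hya, hyb⟩ := hbranch s hs
    have hbound : ∀ y' : List α, y'.length ≤ n →
        overlapWeight lam u (s ++ y') ≤ 6 * n + 6 := by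
      intro y' hy'
      have h1 := overlapWeight_append_le hlam u s y'
      have h2 : lam ^ y'.length ≤ 3 / 2 := (pow_le_pow_right₀ hlam hy').trans hn
      have h3 : (y'.length : ℝ) ≤ n := by exact_mod_cast hy'
      have h4 : (0 : ℝ) ≤ lam ^ y'.length := by positivity
      have h5 : lam ^ y'.length * (overlapWeight lam u s + y'.length) ≤
          lam ^ y'.length * (4 * n + 4) :=
        mul_le_mul_of_nonneg_left (by linarith) h4
      nlinarith
    have hsmall : lam * overlapWeight lam u (s ++ y) ≤ 6 * n + 6 := by
      have h1 := mul_le_mul_of_nonneg_left (overlapWeight_append_le hlam u s y) hlam0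
      have h2 : lam ^ (y.length + 1) ≤ 3 / 2 := (pow_le_pow_right₀ hlam hy).trans hn
      have h3 : (y.length : ℝ) ≤ n := by exact_mod_cast hy.le
      have h4 : (0 : ℝ) ≤ lam ^ (y.length + 1) := by positivity
      have h5 : lam ^ (y.length + 1) * (overlapWeight lam u s + y.length) ≤
          lam ^ (y.length + 1) * (4 * n + 4) :=
        mul_le_mul_of_nonneg_left (by linarith) h4
      rw [← mul_assoc, ← pow_succ'] at h1
      nlinarith
    have hsum := overlapWeight_concat_add_le hlam0 u (s ++ y) hab
    have key : ∀ c, s ++ y ++ [c] ∈ L → overlapWeight lam u (s ++ y ++ [c]) ≤ 3 * n + 4 →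
        ∃ s ∈ L, k + 1 ≤ s.length ∧ ¬ u <:+: s ∧ overlapWeight lam u s ≤ 3 * n + 4 := by
      intro c hc hcw
      refine ⟨_, hc, by simp; omega, ?_, hcw⟩
      rw [List.append_assoc]
      refine not_infix_append hlam0 hus fun y' hy' => (hbound y' ?_).trans_lt hu
      have := hy'.length_le
      simp at this
      omega
    rcases le_total (overlapWeight lam u (s ++ y ++ [a])) (overlapWeight lam u (s ++ y ++ [b]))
      with h | h
    · exact key a hya (by linarith)
    · exact key b hyb (by linarith)

end Avoidance

/-- In a uniformly recurrent language, some words `w` have, for a given number `n` of letters, only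
one extension: otherwise one could branch again and again, and avoid a long word. -/
theorem IsUniformlyRecurrent.exists_unique_extension {α : Type*} {L : Set (List α)}
    (hL : IsUniformlyRecurrent L) (n : ℕ) :
    ∃ w v : List α, v.length = n ∧ w ++ v ∈ L ∧
      ∀ (i : ℕ) (hi : i < v.length) (a : α), w ++ v.take i ++ [a] ∈ L → a = v[i] := by
  obtain ⟨w, hw, hwu⟩ : ∃ w ∈ L, ∀ (y : List α) (a b : α), y.length < n →
      w ++ y ++ [a] ∈ L → w ++ y ++ [b] ∈ L → a = b := by
    by_contra! hcon
    obtain ⟨lam, hlam, hlamn⟩ : ∃ lam : ℝ, 1 < lam ∧ lam ^ n ≤ 3 / 2 := by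
      rcases Nat.eq_zero_or_pos n with rfl | hn
      · exact ⟨2, by norm_num, by norm_num⟩
      · refine ⟨(3 / 2 : ℝ) ^ ((n : ℝ)⁻¹), Real.one_lt_rpow (by norm_num) (by positivity), ?_⟩
        rw [Real.rpow_inv_natCast_pow (by norm_num) hn.ne']
    obtain ⟨N, hN⟩ := pow_unbounded_of_one_lt (6 * (n : ℝ) + 6) hlam
    obtain ⟨u, hu, rfl⟩ := hL.exists_length_eq N
    obtain ⟨k, hk⟩ := hL.exists_infix u hu
    obtain ⟨s, hs, hks, hus⟩ := exists_long_not_infix hlam.le hlamn hL.nil_mem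
      (fun w hw => by
        obtain ⟨y, a, b, h1, h2, h3, h4⟩ := hcon w hw
        exact ⟨y, a, b, h1, h4, h2, h3⟩) hN k
    exact hus (hk s hs hks)
  suffices H : ∀ k ≤ n, ∃ v : List α, v.length = k ∧ w ++ v ∈ L ∧
      ∀ (i : ℕ) (hi : i < v.length) (a : α), w ++ v.take i ++ [a] ∈ L → a = v[i] by
    obtain ⟨v, h⟩ := H n le_rfl
    exact ⟨w, v, h⟩
  intro k
  induction k with
  | zero => exact fun _ => ⟨[], rfl, by simpa using hw, by simp⟩
  | succ k ih =>
    intro hk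
    obtain ⟨v, hv, hwv, hvu⟩ := ih (by omega)
    obtain ⟨c, hc⟩ := hL.exists_concat_mem hwv
    refine ⟨v ++ [c], by simp [hv], by simpa using hc, fun i hi a ha => ?_⟩
    rw [List.length_append, List.length_singleton] at hi
    rcases Nat.lt_succ_iff_lt_or_eq.1 hi with hi' | rfl
    · rw [List.getElem_append_left hi']
      rw [List.take_append_of_le_length hi'.le] at ha
      exact hvu i hi' a ha
    · rw [List.take_left] at ha
      simp only [List.getElem_concat_length]
      exact hwu v a c (by omega) ha hc

/-! ### Følner subspaces for operators indexed by letters -/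

section LetterOperators

variable {K α M : Type*} [Field K] [AddCommGroup M] [Module K M]

/-- The operator of a word, for operators `T a` attached to the letters. The letters act from the
right: the first letter of the word is applied first. -/
def wordOp (T : α → Module.End K M) (w : List α) : Module.End K M :=
  (w.reverse.map T).prod

@[simp]
theorem wordOp_nil (T : α → Module.End K M) : wordOp T [] = 1 := by simp [wordOp]

theorem wordOp_append (T : α → Module.End K M) (s t : List α) :
    wordOp T (s ++ t) = wordOp T t * wordOp T s := by simp [wordOp]

@[simp]
theorem wordOp_singleton (T : α → Module.End K M) (a : α) : wordOp T [a] = T a := by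
  simp [wordOp]

/-- The sum of a subspace and of its images under the operators of the letters. -/
def letterHull (T : α → Module.End K M) (E : Submodule K M) : Submodule K M :=
  E ⊔ ⨆ a, E.map (T a)

variable {T : α → Module.End K M}

theorem le_letterHull (E : Submodule K M) : E ≤ letterHull T E := le_sup_left

theorem apply_mem_letterHull {E : Submodule K M} (a : α) {x : M} (hx : x ∈ E) :
    T a x ∈ letterHull T E :=
  (le_sup_of_le_right (le_iSup (fun a => E.map (T a)) a) : E.map (T a) ≤ letterHull T E)
    (Submodule.mem_map_of_mem hx)

theorem letterHull_le {E G : Submodule K M} (h : E ≤ G) (h' : ∀ a, ∀ x ∈ E, T a x ∈ G) :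
    letterHull T E ≤ G :=
  sup_le h (iSup_le fun a => Submodule.map_le_iff_le_comap.2 (h' a))

theorem letterHull_mono : Monotone (letterHull T) := fun _ _ h =>
  letterHull_le (h.trans (le_letterHull _)) fun a _ hx => apply_mem_letterHull a (h hx)

theorem letterHull_sup_le (E G : Submodule K M) :
    letterHull T (E ⊔ G) ≤ letterHull T E ⊔ letterHull T G := by
  refine letterHull_le (sup_le_sup (le_letterHull _) (le_letterHull _)) fun a x hx => ?_
  obtain ⟨y, hy, z, hz, rfl⟩ := Submodule.mem_sup.1 hx
  rw [map_add]
  exact Submodule.add_mem_sup (apply_mem_letterHull a hy) (apply_mem_letterHull a hz)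

theorem letterHull_iterate_sup_le (r : ℕ) (E G : Submodule K M) :
    (letterHull T)^[r] (E ⊔ G) ≤ (letterHull T)^[r] E ⊔ (letterHull T)^[r] G := by
  induction r with
  | zero => rfl
  | succ r ih =>
    simp only [Function.iterate_succ_apply']
    exact (letterHull_mono ih).trans (letterHull_sup_le _ _)

theorem letterHull_iterate_le {E : Submodule K M} (h : letterHull T E ≤ E) (r : ℕ) :
    (letterHull T)^[r] E ≤ E := by
  induction r with
  | zero => rfl
  | succ r ih =>
    rw [Function.iterate_succ_apply']
    exact (letterHull_mono ih).trans h

theorem wordOp_mem_letterHull_iterate {E : Submodule K M} {x : M} (hx : x ∈ E) {r : ℕ}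
    {w : List α} (hw : w.length ≤ r) : wordOp T w x ∈ (letterHull T)^[r] E := by
  induction r generalizing w with
  | zero => simpa [List.length_eq_zero_iff.1 (Nat.le_zero.1 hw)] using hx
  | succ r ih =>
    rw [Function.iterate_succ_apply']
    rcases List.eq_nil_or_concat w with rfl | ⟨w, a, rfl⟩
    · exact le_letterHull _ (ih (by simp))
    · rw [List.concat_eq_append, wordOp_append, wordOp_singleton]
      exact apply_mem_letterHull a (ih (by simpa using hw))

theorem wordOp_mem {E : Submodule K M} (h : letterHull T E ≤ E) {x : M} (hx : x ∈ E)
    (w : List α) : wordOp T w x ∈ E :=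
  letterHull_iterate_le h _ (wordOp_mem_letterHull_iterate hx le_rfl)

variable [Finite α]

theorem finiteDimensional_letterHull (E : Submodule K M) [FiniteDimensional K E] :
    FiniteDimensional K (letterHull T E) := by
  unfold letterHull
  infer_instance

theorem finiteDimensional_letterHull_iterate (r : ℕ) (E : Submodule K M)
    [FiniteDimensional K E] : FiniteDimensional K ((letterHull T)^[r] E) := by
  induction r with
  | zero => assumption
  | succ r ih =>
    rw [Function.iterate_succ_apply']
    exact finiteDimensional_letterHull _

variable {L : Set (List α)}

/-- No word `w` of `L` acts as `0` modulo a proper finite-dimensional invariant subspace `F` that is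
contained in no larger one: otherwise all but finitely many words of `L` would act as `0` modulo
`F`, and `F` and any one vector would generate a finite-dimensional invariant subspace. -/
theorem exists_wordOp_notMem (hL : IsUniformlyRecurrent L) (hT : ∀ w ∉ L, wordOp T w = 0)
    {F : Submodule K M} [FiniteDimensional K F] (hF : letterHull T F ≤ F) (hne : F ≠ ⊤)
    (hmax : ∀ G : Submodule K M, FiniteDimensional K G → letterHull T G ≤ G → F ≤ G → G ≤ F)
    {w : List α} (hw : w ∈ L) : ∃ m, wordOp T w m ∉ F := by
  by_contra! hcon
  obtain ⟨m, hm⟩ : ∃ m, m ∉ F := by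
    by_contra! h
    exact hne (Submodule.eq_top_iff'.2 h)
  obtain ⟨N, hN⟩ := hL.exists_infix w hw
  let B : Submodule K M := Submodule.span K ((fun x => wordOp T x m) '' {x | x.length < N + 1})
  have : FiniteDimensional K B :=
    FiniteDimensional.span_of_finite K ((List.finite_length_lt α (N + 1)).image _)
  have hmB : ∀ x : List α, x.length < N + 1 → wordOp T x m ∈ F ⊔ B := fun x hx =>
    Submodule.mem_sup_right (Submodule.subset_span ⟨x, hx, rfl⟩)
  refine hm (hmax (F ⊔ B) inferInstance ?_ le_sup_left (hmB [] (by simp)))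
  refine letterHull_le le_rfl fun a x hx => ?_
  change x ∈ (F ⊔ B).comap (T a)
  revert x
  change F ⊔ B ≤ (F ⊔ B).comap (T a)
  refine sup_le (fun y hy => Submodule.mem_sup_left (hF (apply_mem_letterHull a hy)))
    (Submodule.span_le.2 ?_)
  rintro _ ⟨x, hx, rfl⟩
  change T a (wordOp T x m) ∈ F ⊔ B
  have hxa : T a (wordOp T x m) = wordOp T (x ++ [a]) m := by simp [wordOp_append]
  rw [hxa]
  by_cases hlen : (x ++ [a]).length < N + 1
  · exact hmB _ hlen
  · by_cases hxL : x ++ [a] ∈ L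
    · obtain ⟨p, q, hpq⟩ := hN _ hxL (by omega)
      rw [← hpq, wordOp_append, wordOp_append]
      exact Submodule.mem_sup_left (wordOp_mem hF (hcon _) q)
    · simp [hT _ hxL]

/-- An infinite-dimensional space has arbitrarily large finite-dimensional subspaces whose
dimension grows at most by `r` under the words of length at most `r`: invariant ones, or else,
modulo the largest invariant one, the span of the first images of a vector along a path on which
words have a unique extension. -/
theorem exists_finrank_letterHull_iterate_le (hL : IsUniformlyRecurrent L)
    (hT : ∀ w ∉ L, wordOp T w = 0) (hM : ¬ FiniteDimensional K M) (r k : ℕ) :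
    ∃ E : Submodule K M, FiniteDimensional K E ∧ k ≤ Module.finrank K E ∧
      Module.finrank K ((letterHull T)^[r] E) ≤ Module.finrank K E + r := by
  by_cases hbig : ∃ E : Submodule K M, FiniteDimensional K E ∧ letterHull T E ≤ E ∧
      k ≤ Module.finrank K E
  · obtain ⟨E, hE, hinv, hk⟩ := hbig
    exact ⟨E, hE, hk, (Submodule.finrank_mono (letterHull_iterate_le hinv r)).trans
      (Nat.le_add_right _ _)⟩
  push Not at hbig
  obtain ⟨F, hF, hFinv, hmax⟩ : ∃ F : Submodule K M, FiniteDimensional K F ∧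
      letterHull T F ≤ F ∧ ∀ G : Submodule K M, FiniteDimensional K G → letterHull T G ≤ G →
        F ≤ G → G ≤ F := by
    let D : Set ℕ := {d | ∃ F : Submodule K M, FiniteDimensional K F ∧ letterHull T F ≤ F ∧
      Module.finrank K F = d}
    have hD : D.Nonempty := ⟨0, ⊥, inferInstance, letterHull_le le_rfl (by simp), by simp⟩
    have hDb : BddAbove D := ⟨k, by rintro _ ⟨F, h1, h2, rfl⟩; exact (hbig F h1 h2).le⟩
    obtain ⟨F, h1, h2, h3⟩ := Nat.sSup_mem hD hDb
    refine ⟨F, h1, h2, fun G g1 g2 hFG => ?_⟩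
    refine (Submodule.eq_of_le_of_finrank_le hFG ?_).ge
    rw [h3]
    exact le_csSup hDb ⟨G, g1, g2, rfl⟩
  have hne : F ≠ ⊤ := by
    rintro rfl
    exact hM (Module.Finite.equiv (Submodule.topEquiv (R := K) (M := M)))
  obtain ⟨w, v, hv, hwv, huniq⟩ := hL.exists_unique_extension (k + r)
  obtain ⟨m, hm⟩ := exists_wordOp_notMem hL hT hFinv hne hmax hwv
  let z : ℕ → M := fun i => wordOp T (w ++ v.take i) m
  let E : ℕ → Submodule K M := fun i => F ⊔ Submodule.span K (z '' Set.Iic i)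
  have hz : ∀ i, z i ∉ F := fun i hi => hm <| by
    have := wordOp_mem hFinv hi (v.drop i)
    rwa [← Module.End.mul_apply, ← wordOp_append, List.append_assoc, List.take_append_drop] at this
  have hEfin : ∀ i, FiniteDimensional K (E i) := fun i => by
    have : FiniteDimensional K (Submodule.span K (z '' Set.Iic i)) :=
      FiniteDimensional.span_of_finite K ((Set.finite_Iic i).image z)
    infer_instance
  have hzE : ∀ {i j}, j ≤ i → z j ∈ E i := fun hij =>
    Submodule.mem_sup_right (Submodule.subset_span ⟨_, hij, rfl⟩)
  have hEmono : ∀ i, E i ≤ E (i + 1) := fun i =>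
    sup_le_sup le_rfl (Submodule.span_mono (Set.image_mono (Set.Iic_subset_Iic.2 i.le_succ)))
  -- only the next letter of the path continues it, so that the hull moves one step along the path
  have hhull : ∀ i < k + r, letterHull T (E i) ≤ E (i + 1) := by
    intro i hi
    refine letterHull_le (hEmono i) fun a x hx => ?_
    change x ∈ (E (i + 1)).comap (T a)
    revert x
    change E i ≤ (E (i + 1)).comap (T a)
    refine sup_le (fun y hy => Submodule.mem_sup_left (hFinv (apply_mem_letterHull a hy)))
      (Submodule.span_le.2 ?_)
    rintro _ ⟨j, hj, rfl⟩
    have hj' : j ≤ i := hj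
    change T a (wordOp T (w ++ v.take j) m) ∈ E (i + 1)
    have hja : T a (wordOp T (w ++ v.take j) m) = wordOp T (w ++ v.take j ++ [a]) m := by
      rw [wordOp_append T (w ++ v.take j)]; simp
    rw [hja]
    by_cases hmem : w ++ v.take j ++ [a] ∈ L
    · have hjv : j < v.length := by omega
      rw [huniq j hjv a hmem, List.append_assoc, ← List.take_succ_eq_append_getElem hjv]
      exact hzE (by omega)
    · rw [hT _ hmem]
      exact zero_mem _
  have hsucc : ∀ i, Module.finrank K (E (i + 1)) ≤ Module.finrank K (E i) + 1 := by
    intro i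
    have hle : E (i + 1) ≤ E i ⊔ Submodule.span K {z (i + 1)} := by
      refine sup_le (le_sup_of_le_left le_sup_left) (Submodule.span_le.2 ?_)
      rintro _ ⟨j, hj, rfl⟩
      rcases Nat.le_succ_iff.1 (show j ≤ i + 1 from hj) with h | rfl
      · exact Submodule.mem_sup_left (hzE h)
      · exact Submodule.mem_sup_right (Submodule.mem_span_singleton_self _)
    calc Module.finrank K (E (i + 1))
        ≤ Module.finrank K (E i ⊔ Submodule.span K {z (i + 1)} : Submodule K M) :=
          Submodule.finrank_mono hle
      _ ≤ _ := Submodule.finrank_add_le_finrank_add_finrank _ _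
      _ ≤ _ := by gcongr; exact (finrank_span_le_card _).trans (by simp)
  -- if the chain became stationary, then it would have reached an invariant subspace beyond `F`
  have hstrict : ∀ i < k + r, Module.finrank K (E i) < Module.finrank K (E (i + 1)) := by
    intro i hi
    refine Submodule.finrank_lt_finrank_of_lt (lt_of_le_not_ge (hEmono i) fun hle => ?_)
    exact hz 0 (hmax (E i) (hEfin i) ((hhull i hi).trans hle) le_sup_left (hzE i.zero_le))
  have hlow : ∀ i ≤ k + r, i ≤ Module.finrank K (E i) := by
    intro i
    induction i with
    | zero => intro _; exact Nat.zero_le _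
    | succ i ih => intro hi; have := ih (by omega); have := hstrict i (by omega); omega
  have hup : ∀ j, Module.finrank K (E (k + j)) ≤ Module.finrank K (E k) + j := by
    intro j
    induction j with
    | zero => exact le_rfl
    | succ j ih => have := hsucc (k + j); rw [← add_assoc]; omega
  have hiter : ∀ j ≤ r, (letterHull T)^[j] (E k) ≤ E (k + j) := by
    intro j
    induction j with
    | zero => exact fun _ => le_rfl
    | succ j ih =>
      intro hj
      rw [Function.iterate_succ_apply']
      exact (letterHull_mono (ih (by omega))).trans (hhull (k + j) (by omega))
  exact ⟨E k, hEfin k, hlow k (by omega), (Submodule.finrank_mono (hiter r le_rfl)).trans (hup r)⟩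

theorem exists_finrank_letterHull_iterate_lt [Nontrivial M] (hL : IsUniformlyRecurrent L)
    (hT : ∀ w ∉ L, wordOp T w = 0) (r : ℕ) {ε : ℝ} (hε : 0 < ε) (W : Submodule K M)
    [FiniteDimensional K W] :
    ∃ P : Submodule K M, FiniteDimensional K P ∧ W ≤ P ∧
      (Module.finrank K ((letterHull T)^[r] P) : ℝ) < (1 + ε) * Module.finrank K P := by
  by_cases hM : FiniteDimensional K M
  · refine ⟨⊤, inferInstance, le_top, ?_⟩
    have h1 : Module.finrank K ((letterHull T)^[r] (⊤ : Submodule K M)) ≤ Module.finrank K M :=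
      Submodule.finrank_le _
    have h2 : 0 < Module.finrank K M := Module.finrank_pos
    have h1' : (Module.finrank K ((letterHull T)^[r] (⊤ : Submodule K M)) : ℝ) ≤
      Module.finrank K M := by exact_mod_cast h1
    have h2' : (0 : ℝ) < Module.finrank K M := by exact_mod_cast h2
    rw [finrank_top]
    nlinarith
  -- a subspace that is large enough absorbs `W` and its images
  · obtain ⟨k, hk⟩ := exists_nat_gt ((Module.finrank K ((letterHull T)^[r] W) + r : ℝ) / ε)
    rw [div_lt_iff₀ hε] at hk
    obtain ⟨E, hE, hkE, hrE⟩ := exists_finrank_letterHull_iterate_le hL hT hM r k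
    refine ⟨W ⊔ E, inferInstance, le_sup_left, ?_⟩
    have := finiteDimensional_letterHull_iterate (T := T) r W
    have := finiteDimensional_letterHull_iterate (T := T) r E
    have h1 : Module.finrank K ((letterHull T)^[r] (W ⊔ E)) ≤
        Module.finrank K ((letterHull T)^[r] W) + (Module.finrank K E + r) :=
      (Submodule.finrank_mono (letterHull_iterate_sup_le r W E)).trans
        ((Submodule.finrank_add_le_finrank_add_finrank _ _).trans (by gcongr))
    have h2 : Module.finrank K E ≤ Module.finrank K (W ⊔ E : Submodule K M) :=
      Submodule.finrank_mono le_sup_right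
    have h1' : (Module.finrank K ((letterHull T)^[r] (W ⊔ E)) : ℝ) ≤
      Module.finrank K ((letterHull T)^[r] W) + (Module.finrank K E + r) := by exact_mod_cast h1
    have h2' : (Module.finrank K E : ℝ) ≤ Module.finrank K (W ⊔ E : Submodule K M) := by
      exact_mod_cast h2
    have h3 : (k : ℝ) ≤ Module.finrank K (W ⊔ E : Submodule K M) := by
      exact_mod_cast hkE.trans h2
    nlinarith

end LetterOperators

/-! ### The basis of a monomial algebra -/

section MonomialBasis

variable {K α : Type*} [Field K]

/-- The words without factors in `R`, i.e. those whose monomials are non-zero in the monomial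
algebra with relations `R`. -/
def admissibleWords (R : Set (List α)) : Set (List α) :=
  {w | ∀ u ∈ R, ¬ u <:+: w}

theorem admissibleWords_of_infix {R : Set (List α)} {s t : List α} (hst : s <:+: t)
    (ht : t ∈ admissibleWords R) : s ∈ admissibleWords R :=
  fun u hu h => ht u hu (h.trans hst)

theorem nil_mem_admissibleWords {R : Set (List α)} (w : admissibleWords R) :
    [] ∈ admissibleWords R :=
  admissibleWords_of_infix List.nil_infix w.2

theorem freeMonomial_append (s t : List α) :
    freeMonomial K (s ++ t) = freeMonomial K s * freeMonomial K t := by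
  simp [freeMonomial]

theorem monomialOf_append (R : Set (List α)) (s t : List α) :
    monomialOf K R (s ++ t) = monomialOf K R s * monomialOf K R t := by
  simp [monomialOf, freeMonomial_append]

theorem monomialOf_eq_prod (R : Set (List α)) (w : List α) :
    monomialOf K R w = (w.map fun a => monomialOf K R [a]).prod := by
  induction w with
  | nil => simp [monomialOf, freeMonomial]
  | cons a w ih =>
    rw [List.map_cons, List.prod_cons, ← ih, ← monomialOf_append, List.singleton_append]

theorem monomialOf_eq_zero {R : Set (List α)} {w : List α} (hw : w ∉ admissibleWords R) :
    monomialOf K R w = 0 := by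
  simp only [admissibleWords, Set.mem_ofPred_eq, not_forall, not_not] at hw
  obtain ⟨u, hu, s, t, rfl⟩ := hw
  have : monomialOf K R u = 0 := by
    rw [monomialOf, RingQuot.mkAlgHom_rel K (MonomialRel.of u hu), map_zero]
  rw [monomialOf_append, monomialOf_append, this, mul_zero, zero_mul]

theorem span_range_freeMonomial :
    Submodule.span K (Set.range (freeMonomial K (α := α))) = ⊤ := by
  have hone : (1 : FreeAlgebra K α) = freeMonomial K [] := by simp [freeMonomial]
  refine Submodule.eq_top_iff'.2 fun x => ?_
  induction x using FreeAlgebra.induction with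
  | grade0 r =>
    rw [Algebra.algebraMap_eq_smul_one, hone]
    exact Submodule.smul_mem _ _ (Submodule.subset_span ⟨_, rfl⟩)
  | grade1 a => exact Submodule.subset_span ⟨[a], by simp [freeMonomial]⟩
  | mul x y hx hy =>
    have := Submodule.mul_mem_mul hx hy
    rw [Submodule.span_mul_span] at this
    refine Submodule.span_mono ?_ this
    rintro _ ⟨_, ⟨s, rfl⟩, _, ⟨t, rfl⟩, rfl⟩
    exact ⟨s ++ t, freeMonomial_append s t⟩
  | add x y hx hy => exact Submodule.add_mem _ hx hy

theorem span_monomialOf (R : Set (List α)) :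
    Submodule.span K (Set.range fun w : admissibleWords R => monomialOf K R w) = ⊤ := by
  rw [eq_top_iff]
  have h : (⊤ : Submodule K (MonomialAlgebra K R)) =
      (⊤ : Submodule K (FreeAlgebra K α)).map
        (RingQuot.mkAlgHom K (MonomialRel K R)).toLinearMap := by
    rw [Submodule.map_top]
    exact (LinearMap.range_eq_top.2 (RingQuot.mkAlgHom_surjective K _)).symm
  rw [h, ← span_range_freeMonomial, Submodule.map_span, Submodule.span_le]
  rintro _ ⟨_, ⟨w, rfl⟩, rfl⟩
  change monomialOf K R w ∈ Submodule.span K _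
  by_cases hw : w ∈ admissibleWords R
  · exact Submodule.subset_span ⟨⟨w, hw⟩, rfl⟩
  · simp [monomialOf_eq_zero hw]

open Classical in
/-- The letter `a` acts on the space with basis the admissible words by prepending `a`; the result
is `0` if it is not admissible. -/
noncomputable def prependLetter (K : Type*) [Field K] (R : Set (List α)) (a : α) :
    Module.End K (admissibleWords R →₀ K) :=
  Finsupp.linearCombination K fun u : admissibleWords R =>
    if h : a :: u.1 ∈ admissibleWords R then Finsupp.single ⟨a :: u.1, h⟩ 1 else 0

open Classical in
theorem lift_prependLetter_freeMonomial (R : Set (List α)) (w : List α)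
    (u : admissibleWords R) :
    FreeAlgebra.lift K (prependLetter K R) (freeMonomial K w) (Finsupp.single u 1) =
      if h : w ++ u.1 ∈ admissibleWords R then Finsupp.single ⟨w ++ u.1, h⟩ 1 else 0 := by
  induction w with
  | nil => simp [freeMonomial]
  | cons a w ih =>
    have hcons : freeMonomial K (a :: w) = FreeAlgebra.ι K a * freeMonomial K w := by
      simp [freeMonomial]
    rw [hcons, map_mul, Module.End.mul_apply, ih, FreeAlgebra.lift_ι_apply]
    by_cases h : w ++ u.1 ∈ admissibleWords R
    · rw [dif_pos h, prependLetter, Finsupp.linearCombination_single, one_smul]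
      rfl
    · have h' : a :: w ++ u.1 ∉ admissibleWords R := fun h' =>
        h (admissibleWords_of_infix (List.suffix_cons a _).isInfix h')
      rw [dif_neg h, dif_neg h', map_zero]

/-- The representation of the monomial algebra on the space with basis the admissible words. -/
noncomputable def wordRepresentation (K : Type*) [Field K] (R : Set (List α)) :
    MonomialAlgebra K R →ₐ[K] Module.End K (admissibleWords R →₀ K) :=
  RingQuot.liftAlgHom K ⟨FreeAlgebra.lift K (prependLetter K R), by
    classical
    rintro _ _ ⟨w, hw⟩
    rw [map_zero]
    refine Finsupp.lhom_ext' fun u => LinearMap.ext_ring ?_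
    have h : w ++ u.1 ∉ admissibleWords R := fun h => h w hw (List.prefix_append _ _).isInfix
    change FreeAlgebra.lift K (prependLetter K R) (freeMonomial K w) (Finsupp.single u 1) = 0
    rw [lift_prependLetter_freeMonomial, dif_neg h]⟩

theorem linearIndependent_monomialOf (R : Set (List α)) :
    LinearIndependent K fun w : admissibleWords R => monomialOf K R w := by
  classical
  rcases isEmpty_or_nonempty (admissibleWords R) with _ | ⟨⟨w₀⟩⟩
  · exact linearIndependent_empty_type
  let e : admissibleWords R := ⟨[], nil_mem_admissibleWords w₀⟩
  let φ : MonomialAlgebra K R →ₗ[K] (admissibleWords R →₀ K) :=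
    (LinearMap.applyₗ (Finsupp.single e 1)).comp (wordRepresentation K R).toLinearMap
  refine LinearIndependent.of_comp φ ?_
  convert Finsupp.linearIndependent_single_one K (admissibleWords R) with w
  change wordRepresentation K R (RingQuot.mkAlgHom K _ (freeMonomial K w.1))
    (Finsupp.single e 1) = _
  rw [wordRepresentation, RingQuot.liftAlgHom_mkAlgHom_apply, lift_prependLetter_freeMonomial]
  have hw : w.1 ++ e.1 = w.1 := List.append_nil _
  rw [dif_pos (hw.symm ▸ w.2)]
  simp only [hw]

/-- The basis of a monomial algebra that consists of the monomials of the admissible words. -/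
noncomputable def monomialBasis (K : Type*) [Field K] (R : Set (List α)) :
    Module.Basis (admissibleWords R) K (MonomialAlgebra K R) :=
  Module.Basis.mk (linearIndependent_monomialOf R) (span_monomialOf R).ge

@[simp]
theorem monomialBasis_apply (R : Set (List α)) (w : admissibleWords R) :
    monomialBasis K R w = monomialOf K R w := by
  simp [monomialBasis]

theorem finiteDimensional_monomialAlgebra_iff (R : Set (List α)) :
    FiniteDimensional K (MonomialAlgebra K R) ↔ (admissibleWords R).Finite := by
  constructor
  · intro h
    exact Set.finite_coe_iff.1 (Module.Finite.finite_basis (monomialBasis K R))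
  · intro h
    have := h.to_subtype
    exact Module.Finite.of_basis (monomialBasis K R)

theorem exists_le_span_monomialOf {R : Set (List α)} (V : Submodule K (MonomialAlgebra K R))
    [FiniteDimensional K V] :
    ∃ r : ℕ, V ≤ Submodule.span K (monomialOf K R '' {w | w.length ≤ r}) := by
  have hV : V.FG := Module.Finite.iff_fg.1 inferInstance
  induction V, hV using Submodule.fg_induction with
  | singleton x =>
    classical
    let b := monomialBasis K R
    refine ⟨(b.repr x).support.sup fun w => w.1.length, ?_⟩
    rw [Submodule.span_singleton_le_iff_mem]
    nth_rw 2 [← b.linearCombination_repr x]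
    rw [Finsupp.linearCombination_apply]
    refine Submodule.sum_mem _ fun w hw => Submodule.smul_mem _ _ (Submodule.subset_span ?_)
    exact ⟨w.1, Finset.le_sup (f := fun w : admissibleWords R => w.1.length) hw, by simp [b]⟩
  | sup V₁ V₂ _ _ h₁ h₂ =>
    obtain ⟨r₁, h₁⟩ := h₁
    obtain ⟨r₂, h₂⟩ := h₂
    refine ⟨max r₁ r₂, sup_le (h₁.trans (Submodule.span_mono (Set.image_mono ?_)))
      (h₂.trans (Submodule.span_mono (Set.image_mono ?_)))⟩
    · exact fun w (hw : w.length ≤ r₁) => le_max_of_le_left hw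
    · exact fun w (hw : w.length ≤ r₂) => le_max_of_le_right hw

end MonomialBasis

/-! ### Modules over monomial algebras with a uniformly recurrent language -/

section Modules

variable {K α M : Type*} [Field K] [Finite α] {R : Set (List α)} [AddCommGroup M] [Nontrivial M]
  [Module K M]

/-- In a left module the last letter of a word acts first, so that the letters act from the right
after the words have been reversed. -/
theorem leftExhaustivelyAmenable_of_isUniformlyRecurrent
    (hR : IsUniformlyRecurrent (admissibleWords R))
    [Module (MonomialAlgebra K R) M] [IsScalarTower K (MonomialAlgebra K R) M] :
    LeftExhaustivelyAmenable K (MonomialAlgebra K R) M := by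
  intro V hV ε hε W hW
  let T : α → Module.End K M := fun a => Algebra.lsmul K K M (monomialOf K R [a])
  have hop : ∀ w, wordOp T w = Algebra.lsmul K K M (monomialOf K R w.reverse) := fun w => by
    rw [monomialOf_eq_prod, map_list_prod, List.map_map]
    rfl
  obtain ⟨r, hr⟩ := exists_le_span_monomialOf V
  obtain ⟨P, hP, hWP, hlt⟩ := exists_finrank_letterHull_iterate_lt hR.reverse (T := T)
    (fun w hw => by rw [hop, monomialOf_eq_zero hw, map_zero]) r hε W
  refine ⟨P, hP, hWP, lt_of_le_of_lt ?_ hlt⟩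
  have := finiteDimensional_letterHull_iterate (T := T) r P
  refine Nat.cast_le.2 (Submodule.finrank_mono (Submodule.span_le.2 ?_))
  rintro _ ⟨v, hv, l, hl, rfl⟩
  have hle : Submodule.span K (monomialOf K R '' {w | w.length ≤ r}) ≤
      ((letterHull T)^[r] P).comap
        ((LinearMap.applyₗ l).comp (Algebra.lsmul K K M).toLinearMap) := by
    refine Submodule.span_le.2 ?_
    rintro _ ⟨w, hw, rfl⟩
    have := wordOp_mem_letterHull_iterate (T := T) hl (w := w.reverse) (r := r) (by simpa using hw)
    rwa [hop, List.reverse_reverse] at this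
  exact hle (hr hv)

theorem rightExhaustivelyAmenable_of_isUniformlyRecurrent
    (hR : IsUniformlyRecurrent (admissibleWords R))
    [Module (MonomialAlgebra K R)ᵐᵒᵖ M] [IsScalarTower K (MonomialAlgebra K R)ᵐᵒᵖ M] :
    RightExhaustivelyAmenable K (MonomialAlgebra K R) M := by
  intro V hV ε hε W hW
  let T : α → Module.End K M := fun a => Algebra.lsmul K K M (op (monomialOf K R [a]))
  have hop : ∀ w, wordOp T w = Algebra.lsmul K K M (op (monomialOf K R w)) := fun w => by
    rw [monomialOf_eq_prod, op_list_prod, map_list_prod, List.map_reverse, List.map_map,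
      List.map_map, wordOp, List.map_reverse]
    rfl
  obtain ⟨r, hr⟩ := exists_le_span_monomialOf V
  obtain ⟨P, hP, hWP, hlt⟩ := exists_finrank_letterHull_iterate_lt hR (T := T)
    (fun w hw => by rw [hop, monomialOf_eq_zero hw, op_zero, map_zero]) r hε W
  refine ⟨P, hP, hWP, lt_of_le_of_lt ?_ hlt⟩
  have := finiteDimensional_letterHull_iterate (T := T) r P
  refine Nat.cast_le.2 (Submodule.finrank_mono (Submodule.span_le.2 ?_))
  rintro _ ⟨v, hv, l, hl, rfl⟩
  have hle : Submodule.span K (monomialOf K R '' {w | w.length ≤ r}) ≤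
      ((letterHull T)^[r] P).comap ((LinearMap.applyₗ l).comp
        ((Algebra.lsmul K K M).toLinearMap.comp (opLinearEquiv K).toLinearMap)) := by
    refine Submodule.span_le.2 ?_
    rintro _ ⟨w, hw, rfl⟩
    have := wordOp_mem_letterHull_iterate (T := T) hl (w := w) (r := r) hw
    rwa [hop] at this
  exact hle (hr hv)

end Modules

/-! ### Projectively simple monomial algebras -/

section ProjectivelySimple

variable {K α : Type*} [Field K]

/-- The quotient map between monomial algebras that imposes further monomial relations. -/
noncomputable def addRelations (K : Type*) [Field K] {R R' : Set (List α)} (h : R ⊆ R') :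
    MonomialAlgebra K R →ₐ[K] MonomialAlgebra K R' :=
  RingQuot.liftAlgHom K ⟨RingQuot.mkAlgHom K (MonomialRel K R'), by
    rintro _ _ ⟨w, hw⟩
    exact RingQuot.mkAlgHom_rel K (MonomialRel.of w (h hw))⟩

theorem addRelations_monomialOf {R R' : Set (List α)} (h : R ⊆ R') (w : List α) :
    addRelations K h (monomialOf K R w) = monomialOf K R' w :=
  RingQuot.liftAlgHom_mkAlgHom_apply ..

theorem addRelations_surjective {R R' : Set (List α)} (h : R ⊆ R') :
    Function.Surjective (addRelations K h) := by
  intro y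
  obtain ⟨x, rfl⟩ := RingQuot.mkAlgHom_surjective K _ y
  exact ⟨RingQuot.mkAlgHom K _ x, RingQuot.liftAlgHom_mkAlgHom_apply ..⟩

theorem admissibleWords_anti {R R' : Set (List α)} (h : R ⊆ R') :
    admissibleWords R' ⊆ admissibleWords R := fun _ hw u hu => hw u (h hu)

theorem monomialBasis_repr_addRelations {R R' : Set (List α)} (h : R ⊆ R')
    (x : MonomialAlgebra K R) (w : admissibleWords R') :
    (monomialBasis K R').repr (addRelations K h x) w =
      (monomialBasis K R).repr x ⟨w.1, admissibleWords_anti h w.2⟩ := by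
  classical
  let f : MonomialAlgebra K R →ₗ[K] K := (Finsupp.lapply w).comp
    ((monomialBasis K R').repr.toLinearMap.comp (addRelations K h).toLinearMap)
  let g : MonomialAlgebra K R →ₗ[K] K :=
    (Finsupp.lapply ⟨w.1, admissibleWords_anti h w.2⟩).comp (monomialBasis K R).repr.toLinearMap
  suffices hfg : f = g from LinearMap.congr_fun hfg x
  refine (monomialBasis K R).ext fun v => ?_
  change (monomialBasis K R').repr (addRelations K h (monomialBasis K R v)) w =
    (monomialBasis K R).repr (monomialBasis K R v) ⟨w.1, admissibleWords_anti h w.2⟩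
  rw [Module.Basis.repr_self, monomialBasis_apply, addRelations_monomialOf]
  by_cases hv : v.1 ∈ admissibleWords R'
  · have : monomialOf K R' v.1 = monomialBasis K R' ⟨v.1, hv⟩ := by simp
    rw [this, Module.Basis.repr_self]
    simp only [Finsupp.single_apply, Subtype.ext_iff]
  · rw [monomialOf_eq_zero hv, map_zero, Finsupp.single_apply, if_neg]
    · rfl
    · rintro rfl
      exact hv w.2

/-- The kernel is spanned by the monomials of the words that become inadmissible. -/
theorem isHomogeneousIdeal_ker_addRelations {R R' : Set (List α)} (h : R ⊆ R') :
    IsHomogeneousIdeal K (monomialDegree K R) (TwoSidedIdeal.ker (addRelations K h)) := by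
  intro x hx
  have hx' : addRelations K h x = 0 := by
    simpa [idealSubspace, TwoSidedIdeal.mem_ker] using hx
  rw [← (monomialBasis K R).linearCombination_repr x, Finsupp.linearCombination_apply]
  refine Submodule.sum_mem _ fun w hw => Submodule.smul_mem _ _ ?_
  refine Submodule.mem_iSup_of_mem w.1.length ⟨?_, Submodule.subset_span ⟨w.1, rfl, by simp⟩⟩
  have hw' : w.1 ∉ admissibleWords R' := fun hw' => by
    have := monomialBasis_repr_addRelations h x ⟨w.1, hw'⟩
    rw [hx', map_zero] at this
    exact Finsupp.mem_support_iff.1 hw this.symm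
  simp [idealSubspace, TwoSidedIdeal.mem_ker, addRelations_monomialOf, monomialOf_eq_zero hw']

/-- The ideal generated by a non-zero word has finite codimension, so that there are only finitely
many words that avoid it. -/
theorem IsProjectivelySimple.isUniformlyRecurrent [Finite α] {R : Set (List α)}
    (hR : IsProjectivelySimple K (monomialDegree K R)) :
    IsUniformlyRecurrent (admissibleWords R) where
  mem_of_infix _ _ := admissibleWords_of_infix
  exists_le_length n := by
    by_contra! hcon
    exact hR.1 ((finiteDimensional_monomialAlgebra_iff R).2
      ((List.finite_length_lt α n).subset hcon))
  exists_infix u hu := by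
    have h : R ⊆ insert u R := Set.subset_insert u R
    have hu' : u ∉ admissibleWords (insert u R) := fun hu' =>
      hu' u (Set.mem_insert _ _) List.infix_rfl
    have hne : TwoSidedIdeal.ker (addRelations K h) ≠ ⊥ := by
      intro hbot
      have hmem : monomialOf K R u ∈ TwoSidedIdeal.ker (addRelations K h) := by
        rw [TwoSidedIdeal.mem_ker, addRelations_monomialOf, monomialOf_eq_zero hu']
      rw [hbot, TwoSidedIdeal.mem_bot] at hmem
      exact (monomialBasis K R).ne_zero ⟨u, hu⟩ (by simpa using hmem)
    have hfin := hR.2 _ hne (isHomogeneousIdeal_ker_addRelations h)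
    have hle : idealSubspace K (TwoSidedIdeal.ker (addRelations K h)) ≤
        LinearMap.ker (addRelations K h).toLinearMap := fun x hx => by
      simpa [idealSubspace, TwoSidedIdeal.mem_ker] using hx
    have : FiniteDimensional K (MonomialAlgebra K (insert u R)) :=
      Module.Finite.of_surjective (Submodule.liftQ _ _ hle) fun y => by
        obtain ⟨x, rfl⟩ := addRelations_surjective h y
        exact ⟨Submodule.Quotient.mk x, rfl⟩
    have hfin' := (finiteDimensional_monomialAlgebra_iff (K := K) _).1 this
    obtain ⟨N, hN⟩ := (hfin'.image List.length).bddAbove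
    refine ⟨N + 1, fun w hw hlen => ?_⟩
    by_contra hcon
    have hw' : w ∈ admissibleWords (insert u R) := by
      rintro t (rfl | ht)
      · exact hcon
      · exact hw t ht
    have : w.length ≤ N := hN ⟨w, hw', rfl⟩
    omega

end ProjectivelySimple

/-! ### Minimal subshifts -/

section Subshifts

variable {α : Type*} [TopologicalSpace α]

/-- The word `u` occurs in `x` at the position `i`. -/
def OccursAt (u : List α) (x : ℤ → α) (i : ℤ) : Prop :=
  ∀ (j : ℕ) (hj : j < u.length), x (i + j) = u[j]

theorem factors_of_infix (X : Subshift α ℤ) {s t : List α} (hst : s <:+: t)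
    (ht : t ∈ factors X) : s ∈ factors X := by
  obtain ⟨p, q, rfl⟩ := hst
  obtain ⟨x, hx, i, hi⟩ := ht
  refine ⟨x, hx, i + p.length, fun j hj => ?_⟩
  have := hi (p.length + j) (by simp; omega)
  simp only [List.append_assoc, List.getElem_append_right (Nat.le_add_right _ _),
    Nat.add_sub_cancel_left, List.getElem_append_left hj] at this
  rw [← this, Nat.cast_add, add_assoc]

theorem admissibleWords_compl_factors (X : Subshift α ℤ) :
    admissibleWords (factors X)ᶜ = factors X := by
  ext w
  constructor
  · intro hw
    by_contra h
    exact hw w h List.infix_rfl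
  · exact fun hw u hu h => hu (factors_of_infix X h hw)

theorem isClosed_avoiding [DiscreteTopology α] (X : Subshift α ℤ) (u : List α) (S : Set ℤ) :
    IsClosed (X.carrier ∩ {x | ∀ i ∈ S, ¬ OccursAt u x i}) := by
  refine X.isClosed.inter ?_
  have hset : {x : ℤ → α | ∀ i ∈ S, ¬ OccursAt u x i} =
      ⋂ i ∈ S, (⋂ j : Fin u.length, (fun x : ℤ → α => x (i + (j : ℕ))) ⁻¹' {u[j]})ᶜ := by
    ext x
    simp [OccursAt, Fin.exists_iff]
  rw [hset]
  refine isClosed_biInter fun i _ => IsOpen.isClosed_compl ?_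
  exact isOpen_iInter_of_finite fun j => (isOpen_discrete _).preimage (continuous_apply _)

/-- The points of a subshift in which a word does not occur. -/
def avoidingSubshift [DiscreteTopology α] (X : Subshift α ℤ) (u : List α) : Subshift α ℤ where
  carrier := X.carrier ∩ {x | ∀ i ∈ (Set.univ : Set ℤ), ¬ OccursAt u x i}
  isClosed := isClosed_avoiding X u Set.univ
  mapsTo := by
    rintro g x ⟨hx, hxu⟩
    refine ⟨X.mapsTo g hx, fun i _ hi => hxu (g + i) trivial fun j hj => ?_⟩
    rw [← hi j hj, add_assoc]
    rfl

/-- If there were arbitrarily long factors without the factor `u`, then by compactness `u` would not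
occur in some points of `X`, and those points would form a proper subshift. -/
theorem isUniformlyRecurrent_factors [Finite α] [DiscreteTopology α] {X : Subshift α ℤ}
    (hX : IsMinimalSubshift X) : IsUniformlyRecurrent (factors X) where
  mem_of_infix _ _ := factors_of_infix X
  exists_le_length n := by
    obtain ⟨x, hx⟩ := hX.1
    exact ⟨List.ofFn fun j : Fin n => x j, ⟨x, hx, 0, by simp⟩, by simp⟩
  exists_infix u hu := by
    by_contra! hcon
    let t : ℕ → Set (ℤ → α) := fun n =>
      X.carrier ∩ {x | ∀ i ∈ Set.Icc (-n : ℤ) n, ¬ OccursAt u x i}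
    have hanti : ∀ n, t (n + 1) ⊆ t n := fun n x hx =>
      ⟨hx.1, fun i hi => hx.2 i (Set.Icc_subset_Icc (by push_cast; omega) (by push_cast; omega) hi)⟩
    -- centre a long factor that avoids `u` at the origin
    have hne : ∀ n, (t n).Nonempty := by
      intro n
      obtain ⟨w, ⟨x, hx, i, hi⟩, hlen, hw⟩ := hcon (2 * n + 1 + u.length)
      refine ⟨shift (i + n) x, X.mapsTo _ hx, fun k hk hocc => hw ?_⟩
      obtain ⟨m, hm⟩ := Int.eq_ofNat_of_zero_le (by have := hk.1; omega : 0 ≤ n + k)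
      have hmn : m ≤ 2 * n := by have := hk.2; omega
      have hu' : u = (w.drop m).take u.length := by
        refine List.ext_getElem (by simp; omega) fun j hj _ => ?_
        rw [List.getElem_take, List.getElem_drop, ← hocc j hj, ← hi (m + j) (by omega)]
        rw [shift_apply]
        congr 1
        push_cast
        omega
      rw [hu']
      exact (List.take_prefix _ _).isInfix.trans (List.drop_suffix _ _).isInfix
    have hcl : ∀ n, IsClosed (t n) := fun n => isClosed_avoiding X u _
    obtain ⟨y, hy⟩ := IsCompact.nonempty_iInter_of_sequence_nonempty_isCompact_isClosed t hanti hne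
      (hcl 0).isCompact hcl
    rw [Set.mem_iInter] at hy
    have hY := hX.2 (avoidingSubshift X u)
      ⟨y, (hy 0).1, fun i _ => (hy i.natAbs).2 i (by constructor <;> omega)⟩
      Set.inter_subset_left
    obtain ⟨x, hx, i, hi⟩ := hu
    rw [← hY] at hx
    exact hx.2 i trivial hi

end Subshifts

theorem theorem1p1 {K : Type*} [Field K]
    {α : Type*} [Finite α] [TopologicalSpace α] [DiscreteTopology α] :
    (∀ X : Subshift α ℤ, IsMinimalSubshift X →
      (∀ (M : Type*) [AddCommGroup M] [Nontrivial M] [Module K M]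
          [Module (SubshiftAlgebra K X) M] [IsScalarTower K (SubshiftAlgebra K X) M],
          LeftExhaustivelyAmenable K (SubshiftAlgebra K X) M) ∧
      (∀ (M : Type*) [AddCommGroup M] [Nontrivial M] [Module K M]
          [Module (SubshiftAlgebra K X)ᵐᵒᵖ M] [IsScalarTower K (SubshiftAlgebra K X)ᵐᵒᵖ M],
          RightExhaustivelyAmenable K (SubshiftAlgebra K X) M)) ∧
    (∀ R : Set (List α), IsProjectivelySimple K (monomialDegree K R) →
      (∀ (M : Type*) [AddCommGroup M] [Nontrivial M] [Module K M]
          [Module (MonomialAlgebra K R) M] [IsScalarTower K (MonomialAlgebra K R) M],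
          LeftExhaustivelyAmenable K (MonomialAlgebra K R) M) ∧
      (∀ (M : Type*) [AddCommGroup M] [Nontrivial M] [Module K M]
          [Module (MonomialAlgebra K R)ᵐᵒᵖ M] [IsScalarTower K (MonomialAlgebra K R)ᵐᵒᵖ M],
          RightExhaustivelyAmenable K (MonomialAlgebra K R) M)) := by
  refine ⟨fun X hX => ?_, fun R hR => ?_⟩
  · have h : IsUniformlyRecurrent (admissibleWords (factors X)ᶜ) := by
      rw [admissibleWords_compl_factors]
      exact isUniformlyRecurrent_factors hX
    exact ⟨fun M _ _ _ _ _ => leftExhaustivelyAmenable_of_isUniformlyRecurrent h,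
      fun M _ _ _ _ _ => rightExhaustivelyAmenable_of_isUniformlyRecurrent h⟩
  · exact ⟨fun M _ _ _ _ _ =>
        leftExhaustivelyAmenable_of_isUniformlyRecurrent hR.isUniformlyRecurrent,
      fun M _ _ _ _ _ =>
        rightExhaustivelyAmenable_of_isUniformlyRecurrent hR.isUniformlyRecurrent⟩
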